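/- Let $n\ge 2$ be an odd integer and let $G=SD_{8n}=\langle a,b\mid a^{4n}=b^2=1,\ bab=a^{2n-1}\rangle$ be the semidihedral group of order $8n$, regarded as a subgroup of the symmetric group $S_{4n}$ on the residues modulo $4n$ through $a\mapsto (t\mapsto t+1)$ and $b\mapsto (t\mapsto (2n-1)t)$. Let $h'\in C^{\dagger}_{even}=\{2,4,\dots,2n-2\}$ and let $\varsigma=\varsigma_{h'}$ be the character of the two-dimensional representation $\rho^{h'}$ of $G$ given, with $\omega=e^{i\pi/(2n)}$, by $$\rho^{h'}(a^r)=\begin{pmatrix}\omega^{h'r}&0\\0&\omega^{(2n-1)h'r}\end{pmatrix},\qquad \rho^{h'}(ba^r)=\begin{pmatrix}0&\omega^{(2n-1)h'r}\\ \omega^{h'r}&0\end{pmatrix},$$ so that $\varsigma(a^r)=2\cos\frac{h'r\pi}{2n}$ and $\varsigma(ba^r)=0$. Let $V$ be a finite-dimensional complex inner product space with $d=\dim V\ge 2$ and let $\{e_1,\dots,e_d\}$ be an orthonormal basis of $V$. Put $P_\sigma(v_1\otimes\cdots\otimes v_{4n})=v_{\sigma^{-1}(1)}\otimes\cdots\otimes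 v_{\sigma^{-1}(4n)}$, let $T(G,\varsigma)=\frac{\varsigma(1)}{|G|}\sum_{\sigma\in G}\varsigma(\sigma)P_\sigma$ on $V^{\otimes 4n}$, let $V_\varsigma(G)$ be the image of $T(G,\varsigma)$, with the inner product induced from $V^{\otimes 4n}$, on which $\langle v_1\otimes\cdots\otimes v_{4n},u_1\otimes\cdots\otimes u_{4n}\rangle=\prod_i\langle v_i,u_i\rangle$, and for $\alpha\in\{1,\dots,d\}^{4n}$ let $e^*_\alpha=T(G,\varsigma)(e_{\alpha_1}\otimes\cdots\otimes e_{\alpha_{4n}})$. Then $V_\varsigma(G)$ has no orthogonal $*$-basis, that is, no basis of $V_\varsigma(G)$ consists of pairwise orthogonal vectors of the form $e^*_\alpha$. -/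

import Mathlib

open scoped TensorProduct

/-- The semidihedral group `SD_{8n} = ⟨a, b ∣ a^{4n} = b² = 1, bab = a^{2n-1}⟩`, given by its `8n`
normal forms: `a r` stands for `a^r` and `ba r` stands for `b a^r`, with `r` modulo `4n`. -/
inductive SemidihedralGroup (n : ℕ) : Type
  | a : ZMod (4 * n) → SemidihedralGroup n
  | ba : ZMod (4 * n) → SemidihedralGroup n

namespace SemidihedralGroup

/-- Multiplication of normal forms, forced by `a^r b = b a^{(2n-1)r}` and `b² = 1`. -/
protected def mul {n : ℕ} : SemidihedralGroup n → SemidihedralGroup n → SemidihedralGroup n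
  | a r, a s => a (r + s)
  | a r, ba s => ba ((2 * (n : ZMod (4 * n)) - 1) * r + s)
  | ba r, a s => ba (r + s)
  | ba r, ba s => a ((2 * (n : ZMod (4 * n)) - 1) * r + s)

/-- Inversion of normal forms: `(a^r)⁻¹ = a^{-r}` and `(b a^r)⁻¹ = b a^{(2n+1)r}`. -/
protected def inv {n : ℕ} : SemidihedralGroup n → SemidihedralGroup n
  | a r => a (-r)
  | ba r => ba ((2 * (n : ZMod (4 * n)) + 1) * r)

theorem four_mul_cast_eq_zero (n : ℕ) : (4 * n : ZMod (4 * n)) = 0 := by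
  have h := ZMod.natCast_self (4 * n)
  push_cast at h
  exact h

theorem twist_sq (n : ℕ) : ((2 * n - 1) * (2 * n - 1) : ZMod (4 * n)) = 1 := by
  linear_combination (n - 1 : ZMod (4 * n)) * four_mul_cast_eq_zero n

instance (n : ℕ) : Group (SemidihedralGroup n) where
  mul := SemidihedralGroup.mul
  one := a 0
  inv := SemidihedralGroup.inv
  mul_assoc := by
    have h := twist_sq n
    rintro (r | r) (s | s) (t | t)
    · exact congrArg a (by ring)
    · exact congrArg ba (by ring)
    · exact congrArg ba (by ring)
    · exact congrArg a (by linear_combination (r : ZMod (4 * n)) * h)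
    · exact congrArg ba (by ring)
    · exact congrArg a (by ring)
    · exact congrArg a (by ring)
    · exact congrArg ba (by linear_combination (r : ZMod (4 * n)) * h)
  one_mul := by
    rintro (r | r)
    · exact congrArg a (by ring)
    · exact congrArg ba (by ring)
  mul_one := by
    rintro (r | r)
    · exact congrArg a (by ring)
    · exact congrArg ba (by ring)
  inv_mul_cancel := by
    rintro (r | r)
    · exact congrArg a (by ring)
    · exact congrArg a
        (by linear_combination (n * r : ZMod (4 * n)) * four_mul_cast_eq_zero n)

/-- The normal forms are two copies of `ℤ/4n`. -/
def equivSum (n : ℕ) : SemidihedralGroup n ≃ ZMod (4 * n) ⊕ ZMod (4 * n) where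
  toFun
    | a r => Sum.inl r
    | ba r => Sum.inr r
  invFun
    | Sum.inl r => a r
    | Sum.inr r => ba r
  left_inv := by rintro (r | r) <;> rfl
  right_inv := by rintro (r | r) <;> rfl

instance (n : ℕ) [NeZero n] : Fintype (SemidihedralGroup n) :=
  Fintype.ofEquiv _ (equivSum n).symm

theorem card_eq (n : ℕ) [NeZero n] : Fintype.card (SemidihedralGroup n) = 8 * n := by
  rw [Fintype.card_congr (equivSum n), Fintype.card_sum, ZMod.card]
  ring

theorem a_mul_a {n : ℕ} (r s : ZMod (4 * n)) : a r * a s = a (r + s) := rfl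

theorem a_mul_ba {n : ℕ} (r s : ZMod (4 * n)) :
    a r * ba s = ba ((2 * (n : ZMod (4 * n)) - 1) * r + s) := rfl

theorem ba_mul_a {n : ℕ} (r s : ZMod (4 * n)) : ba r * a s = ba (r + s) := rfl

theorem ba_mul_ba {n : ℕ} (r s : ZMod (4 * n)) :
    ba r * ba s = a ((2 * (n : ZMod (4 * n)) - 1) * r + s) := rfl

theorem one_def {n : ℕ} : (1 : SemidihedralGroup n) = a 0 := rfl

theorem a_one_pow {n : ℕ} (k : ℕ) : (a 1 : SemidihedralGroup n) ^ k = a k := by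
  induction k with
  | zero => simp [one_def]
  | succ k ih => rw [pow_succ, ih, a_mul_a]; push_cast; rfl

/-- Every element is some `a^k` or `b a^k`, where `a = a 1` and `b = ba 0`. -/
theorem eq_pow_or_eq_mul_pow {n : ℕ} [NeZero n] (g : SemidihedralGroup n) :
    ∃ k < 4 * n, g = a 1 ^ k ∨ g = ba 0 * a 1 ^ k := by
  rcases g with (r | r)
  · exact ⟨r.val, ZMod.val_lt r, Or.inl (by rw [a_one_pow, ZMod.natCast_zmod_val])⟩
  · exact ⟨r.val, ZMod.val_lt r,
      Or.inr (by rw [a_one_pow, ZMod.natCast_zmod_val, ba_mul_a, zero_add])⟩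

/-- The defining relations hold for `a = a 1` and `b = ba 0`. -/
theorem relations (n : ℕ) [NeZero n] :
    (a 1 : SemidihedralGroup n) ^ (4 * n) = 1 ∧ (ba 0 : SemidihedralGroup n) ^ 2 = 1 ∧
      (ba 0 * a 1 * ba 0 : SemidihedralGroup n) = a 1 ^ (2 * n - 1) := by
  refine ⟨?_, ?_, ?_⟩
  · rw [a_one_pow, ZMod.natCast_self, one_def]
  · rw [pow_two, ba_mul_ba, one_def]
    simp
  · have h : 1 ≤ 2 * n := by have := NeZero.pos n; omega
    rw [ba_mul_a, ba_mul_ba, a_one_pow]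
    push_cast [h]
    simp

/-- Multiplication by `2n - 1` on `ℤ/4n`, the permutation assigned to `b`. -/
def twist (n : ℕ) : Equiv.Perm (ZMod (4 * n)) where
  toFun t := (2 * (n : ZMod (4 * n)) - 1) * t
  invFun t := (2 * (n : ZMod (4 * n)) - 1) * t
  left_inv t := by linear_combination (t : ZMod (4 * n)) * twist_sq n
  right_inv t := by linear_combination (t : ZMod (4 * n)) * twist_sq n

/-- The homomorphism `SD_{8n} → S_{4n}` with `a ↦ (t ↦ t + 1)` and `b ↦ (t ↦ (2n-1) t)`, where the
`4n` points are the residues modulo `4n`. -/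
def toPerm (n : ℕ) : SemidihedralGroup n →* Equiv.Perm (ZMod (4 * n)) where
  toFun
    | a r => Equiv.addRight r
    | ba r => twist n * Equiv.addRight r
  map_one' := by
    change Equiv.addRight (0 : ZMod (4 * n)) = 1
    ext t
    simp
  map_mul' := by
    have h := twist_sq n
    rintro (r | r) (s | s)
    · exact Equiv.ext fun t => show t + (r + s) = t + s + r by ring
    · exact Equiv.ext fun t => show (2 * n - 1) * (t + ((2 * n - 1) * r + s)) =
        (2 * n - 1) * (t + s) + r by linear_combination (r : ZMod (4 * n)) * h
    · exact Equiv.ext fun t => show (2 * n - 1) * (t + (r + s)) = (2 * n - 1) * (t + s + r) by ring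
    · exact Equiv.ext fun t => show t + ((2 * n - 1) * r + s) =
        (2 * n - 1) * ((2 * n - 1) * (t + s) + r) by
          linear_combination (-(t + s) : ZMod (4 * n)) * h

/-- For `n ≥ 2` the homomorphism is an embedding, so `SD_{8n}` is a subgroup of `S_{4n}`. -/
theorem toPerm_injective {n : ℕ} (hn : 2 ≤ n) : Function.Injective (toPerm n) := by
  have key : ∀ r s : ZMod (4 * n), toPerm n (a r) ≠ toPerm n (ba s) := by
    intro r s h
    have h0 : (0 : ZMod (4 * n)) + r = (2 * n - 1) * (0 + s) := congrArg (fun e => e 0) h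
    have h1 : (1 : ZMod (4 * n)) + r = (2 * n - 1) * (1 + s) := congrArg (fun e => e 1) h
    have h2 : ((2 * n - 2 : ℕ) : ZMod (4 * n)) = 0 := by
      have : 2 ≤ 2 * n := by omega
      push_cast [this]
      linear_combination h0 - h1
    rw [ZMod.natCast_eq_zero_iff] at h2
    have := Nat.le_of_dvd (by omega) h2
    omega
  rintro (r | r) (s | s) h
  · have h0 : (0 : ZMod (4 * n)) + r = 0 + s := congrArg (fun e => e 0) h
    simpa using h0
  · exact absurd h (key r s)
  · exact absurd h.symm (key s r)
  · have h' : twist n * Equiv.addRight r = twist n * Equiv.addRight s := h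
    have h0 : (0 : ZMod (4 * n)) + r = 0 + s := congrArg (fun e => e 0) (mul_left_cancel h')
    simpa using h0

/-- `ω = e^{iπ/(2n)}`, a primitive `4n`-th root of unity. -/
noncomputable def omega (n : ℕ) : ℂ := Complex.exp (Complex.I * Real.pi / (2 * n))

theorem omega_pow_congr {n : ℕ} [NeZero n] {k l : ℕ} (h : (k : ZMod (4 * n)) = l) :
    omega n ^ k = omega n ^ l := by
  have hω : omega n ^ (4 * n) = 1 := by
    have hn : (n : ℂ) ≠ 0 := Nat.cast_ne_zero.2 (NeZero.ne n)
    rw [omega, ← Complex.exp_nat_mul, ← Complex.exp_two_pi_mul_I]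
    congr 1
    push_cast
    field_simp
    ring
  rw [ZMod.natCast_eq_natCast_iff] at h
  rw [← Nat.mod_add_div k (4 * n), ← Nat.mod_add_div l (4 * n), pow_add, pow_add,
    pow_mul _ (4 * n), pow_mul _ (4 * n), hω, one_pow, one_pow, h]

theorem cast_two_mul_sub_one (n : ℕ) [NeZero n] :
    ((2 * n - 1 : ℕ) : ZMod (4 * n)) = 2 * n - 1 := by
  have h : 1 ≤ 2 * n := by have := NeZero.pos n; omega
  push_cast [h]
  rfl

/-- The two-dimensional representation `ρ^h` of `SD_{8n}`, in matrix form. -/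
noncomputable def rho (n h : ℕ) [NeZero n] :
    SemidihedralGroup n →* Matrix (Fin 2) (Fin 2) ℂ where
  toFun
    | a r => !![omega n ^ (h * r.val), 0; 0, omega n ^ ((2 * n - 1) * h * r.val)]
    | ba r => !![0, omega n ^ ((2 * n - 1) * h * r.val); omega n ^ (h * r.val), 0]
  map_one' := by
    change !![omega n ^ (h * (0 : ZMod (4 * n)).val), 0;
      0, omega n ^ ((2 * n - 1) * h * (0 : ZMod (4 * n)).val)] = 1
    simp [Matrix.one_fin_two]
  map_mul' := by
    have hc := cast_two_mul_sub_one n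
    have hs := twist_sq n
    rintro (r | r) (s | s)
    all_goals
      simp only [a_mul_a, a_mul_ba, ba_mul_a, ba_mul_ba, Matrix.mul_fin_two, ← pow_add, mul_zero,
        zero_mul, add_zero, zero_add]
    · rw [omega_pow_congr (k := h * (r + s).val) (l := h * r.val + h * s.val),
        omega_pow_congr (k := (2 * n - 1) * h * (r + s).val)
          (l := (2 * n - 1) * h * r.val + (2 * n - 1) * h * s.val)]
      all_goals
        simp only [Nat.cast_add, Nat.cast_mul, hc, ZMod.natCast_val, ZMod.cast_id', id]
        ring
    · rw [omega_pow_congr (k := h * ((2 * n - 1) * r + s).val)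
          (l := (2 * n - 1) * h * r.val + h * s.val),
        omega_pow_congr (k := (2 * n - 1) * h * ((2 * n - 1) * r + s).val)
          (l := h * r.val + (2 * n - 1) * h * s.val)]
      · simp only [Nat.cast_add, Nat.cast_mul, hc, ZMod.natCast_val, ZMod.cast_id', id]
        linear_combination (h * r : ZMod (4 * n)) * hs
      · simp only [Nat.cast_add, Nat.cast_mul, hc, ZMod.natCast_val, ZMod.cast_id', id]
        ring
    · rw [omega_pow_congr (k := h * (r + s).val) (l := h * r.val + h * s.val),
        omega_pow_congr (k := (2 * n - 1) * h * (r + s).val)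
          (l := (2 * n - 1) * h * r.val + (2 * n - 1) * h * s.val)]
      all_goals
        simp only [Nat.cast_add, Nat.cast_mul, hc, ZMod.natCast_val, ZMod.cast_id', id]
        ring
    · rw [omega_pow_congr (k := h * ((2 * n - 1) * r + s).val)
          (l := (2 * n - 1) * h * r.val + h * s.val),
        omega_pow_congr (k := (2 * n - 1) * h * ((2 * n - 1) * r + s).val)
          (l := h * r.val + (2 * n - 1) * h * s.val)]
      · simp only [Nat.cast_add, Nat.cast_mul, hc, ZMod.natCast_val, ZMod.cast_id', id]
        linear_combination (h * r : ZMod (4 * n)) * hs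
      · simp only [Nat.cast_add, Nat.cast_mul, hc, ZMod.natCast_val, ZMod.cast_id', id]
        ring

/-- The character `ς_h` of `ρ^h`. -/
noncomputable def sigmaChar (n h : ℕ) [NeZero n] (g : SemidihedralGroup n) : ℂ :=
  (rho n h g).trace

/-- The values of `ς_h` on the powers of `a`, for even `h`. -/
theorem sigmaChar_a {n h : ℕ} [NeZero n] (hh : Even h) (r : ZMod (4 * n)) :
    sigmaChar n h (a r) = 2 * Complex.cos (h * r.val * Real.pi / (2 * n)) := by
  have hn : (n : ℂ) ≠ 0 := Nat.cast_ne_zero.2 (NeZero.ne n)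
  have e : ∀ k : ℕ, omega n ^ k = Complex.exp (k * Real.pi / (2 * n) * Complex.I) := by
    intro k
    rw [omega, ← Complex.exp_nat_mul]
    congr 1
    ring
  have hinv : omega n ^ ((2 * n - 1) * h * r.val) * omega n ^ (h * r.val) = 1 := by
    rw [← pow_add, ← pow_zero (omega n)]
    apply omega_pow_congr
    obtain ⟨m, rfl⟩ := hh
    simp only [Nat.cast_add, Nat.cast_mul, cast_two_mul_sub_one, Nat.cast_zero]
    linear_combination (m * r.val : ZMod (4 * n)) * four_mul_cast_eq_zero n
  have h2 : omega n ^ ((2 * n - 1) * h * r.val) =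
      Complex.exp (-((h * r.val : ℕ) * Real.pi / (2 * n)) * Complex.I) := by
    rw [eq_inv_of_mul_eq_one_left hinv, e, ← Complex.exp_neg, neg_mul]
  change Matrix.trace !![omega n ^ (h * r.val), 0; 0, omega n ^ ((2 * n - 1) * h * r.val)] = _
  rw [Matrix.trace_fin_two_of, e, h2, Complex.two_cos]
  push_cast
  rfl

theorem sigmaChar_ba {n h : ℕ} [NeZero n] (r : ZMod (4 * n)) : sigmaChar n h (ba r) = 0 := by
  change Matrix.trace !![0, omega n ^ ((2 * n - 1) * h * r.val); omega n ^ (h * r.val), 0] = _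
  rw [Matrix.trace_fin_two_of, add_zero]

/-- `C₁ = {0, 2, 4, …, 2n}`. -/
def C1 (n : ℕ) : Set ℕ := {k | Even k ∧ k ≤ 2 * n}

/-- `C†_even = C₁ \ {0, 2n}`. -/
def CdagEven (n : ℕ) : Set ℕ := C1 n \ {0, 2 * n}

end SemidihedralGroup

namespace SymmetryClass

section

variable {ι : Type*} [Fintype ι] {V : Type*} [NormedAddCommGroup V] [InnerProductSpace ℂ V]

/-- `u ↦ ⟨v₁ ⊗ ⋯ ⊗ v_m, u⟩` as a linear functional on the tensor power of `V` indexed by `ι`. -/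
noncomputable def innerTprod (v : ι → V) : (⨂[ℂ] _ : ι, V) →ₗ[ℂ] ℂ :=
  PiTensorProduct.lift
    ((MultilinearMap.mkPiAlgebra ℂ ι ℂ).compLinearMap fun i => (innerSL ℂ (v i)).toLinearMap)

theorem innerTprod_tprod (v u : ι → V) :
    innerTprod v (PiTensorProduct.tprod ℂ u) = ∏ i, inner ℂ (v i) (u i) := by
  simp [innerTprod]

/-- The conjugate `y ↦ ⟨y, u₁ ⊗ ⋯ ⊗ u_m⟩` of `innerTprod u`, as a multilinear map in `u`. -/
noncomputable def innerTprodConj :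
    MultilinearMap ℂ (fun _ : ι => V) ((⨂[ℂ] _ : ι, V) →ₗ⋆[ℂ] ℂ) where
  toFun u := (starLinearEquiv ℂ (A := ℂ)).toLinearMap.comp (innerTprod u)
  map_update_add' u i x y := by
    have key : innerTprod (Function.update u i (x + y)) =
        innerTprod (Function.update u i x) + innerTprod (Function.update u i y) := by
      ext v
      simp only [LinearMap.compMultilinearMap_apply, LinearMap.add_apply, innerTprod_tprod,
        ← Finset.mul_prod_erase Finset.univ _ (Finset.mem_univ i), Function.update_self,
        inner_add_left, add_mul]
      congr 2 <;> refine Finset.prod_congr rfl fun j hj => ?_ <;>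
        simp [Function.update_of_ne (Finset.ne_of_mem_erase hj)]
    ext z
    simp [key]
  map_update_smul' u i c x := by
    have key : innerTprod (Function.update u i (c • x)) =
        star c • innerTprod (Function.update u i x) := by
      ext v
      simp only [LinearMap.compMultilinearMap_apply, LinearMap.smul_apply, innerTprod_tprod,
        ← Finset.mul_prod_erase Finset.univ _ (Finset.mem_univ i), Function.update_self,
        inner_smul_left, smul_eq_mul, mul_assoc, starRingEnd_apply]
      congr 2
      refine Finset.prod_congr rfl fun j hj => ?_
      simp [Function.update_of_ne (Finset.ne_of_mem_erase hj)]
    ext z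
    simp [key]

/-- The inner product on the tensor power of `V` induced by the one on `V`: the form, linear in
the second and conjugate-linear in the first argument, with
`⟨v₁ ⊗ ⋯ ⊗ v_m, u₁ ⊗ ⋯ ⊗ u_m⟩ = ∏ i, ⟨vᵢ, uᵢ⟩`. -/
noncomputable def tensorInner (x y : ⨂[ℂ] _ : ι, V) : ℂ :=
  PiTensorProduct.lift innerTprodConj y x

theorem tensorInner_tprod (v u : ι → V) :
    tensorInner (PiTensorProduct.tprod ℂ v) (PiTensorProduct.tprod ℂ u) =
      ∏ i, inner ℂ (v i) (u i) := by
  simp [tensorInner, innerTprodConj, innerTprod_tprod]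

variable {G : Type*} [Group G] [Fintype G]

/-- The symmetrizer `T(G, χ) = χ(1)/|G| ∑_{g ∈ G} χ(g) P_g` of a finite group `G` acting on the
index set `ι` through `T`, where `P_σ (v₁ ⊗ ⋯ ⊗ v_m) = v_{σ⁻¹(1)} ⊗ ⋯ ⊗ v_{σ⁻¹(m)}`. -/
noncomputable def symmetrizer (T : G →* Equiv.Perm ι) (χ : G → ℂ) (V : Type*)
    [NormedAddCommGroup V] [InnerProductSpace ℂ V] :
    (⨂[ℂ] _ : ι, V) →ₗ[ℂ] (⨂[ℂ] _ : ι, V) :=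
  (χ 1 / Fintype.card G) •
    ∑ g, χ g • (PiTensorProduct.reindex ℂ (fun _ : ι => V) (T g)).toLinearMap

/-- The symmetry class of tensors `V_χ(G)`, the image of the symmetrizer. -/
noncomputable def symmetryClass (T : G →* Equiv.Perm ι) (χ : G → ℂ) (V : Type*)
    [NormedAddCommGroup V] [InnerProductSpace ℂ V] : Submodule ℂ (⨂[ℂ] _ : ι, V) :=
  LinearMap.range (symmetrizer T χ V)

/-- The decomposable symmetrized tensor `e*_α = T(G, χ)(e_{α(1)} ⊗ ⋯ ⊗ e_{α(m)})`. -/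
noncomputable def starTensor (T : G →* Equiv.Perm ι) (χ : G → ℂ) {d : ℕ} (e : Fin d → V)
    (α : ι → Fin d) : ⨂[ℂ] _ : ι, V :=
  symmetrizer T χ V (PiTensorProduct.tprod ℂ fun i => e (α i))

/-- `V_χ(G)` has an orthogonal *-basis with respect to the orthonormal basis `e` of `V`: some set of
decomposable symmetrized tensors `e*_α` is a basis of `V_χ(G)` with pairwise orthogonal members. -/
def HasOrthogonalStarBasis (T : G →* Equiv.Perm ι) (χ : G → ℂ) {d : ℕ}
    (e : OrthonormalBasis (Fin d) ℂ V) : Prop :=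
  ∃ B : Set (⨂[ℂ] _ : ι, V),
    B ⊆ Set.range (starTensor T χ e) ∧
    LinearIndepOn ℂ id B ∧
    Submodule.span ℂ B = symmetryClass T χ V ∧
    B.Pairwise fun x y => tensorInner x y = 0

end

end SymmetryClass

/-! ### The character on rotations. -/

namespace SemidihedralGroup

variable {n : ℕ} [NeZero n]

/-! A single orbit of multi-indices already obstructs an orthogonal basis. Mark one point `j` of
`ℤ/4n` with `q` and all others with `p ≠ q`, and let `E j` be the symmetrized tensor. As `ς`
vanishes off the rotations, `⟨E i, E j⟩` and the coordinate of `E j` at the index marked at `i` both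
equal `ς(a^{i-j}) / 4n`. For odd `n` this is never zero (`sigmaChar_a_ne_zero`), so an orthogonal
*-basis contains at most one of the vectors `E j`. Its other members have zero coordinates on this
orbit, so any two such coordinates are proportional on the whole class (`mul_eq_mul_of_mem_span`).
Yet the coordinates at `0` and `1` of `E 0` and `E 1` have determinant `(4 - ς(a)²) / (4n)²`, which
is nonzero (`sigmaChar_a_one_sq_ne`). -/

theorem isPrimitiveRoot_omega (n : ℕ) [NeZero n] : IsPrimitiveRoot (omega n) (4 * n) := by
  have hn : (n : ℂ) ≠ 0 := Nat.cast_ne_zero.2 (NeZero.ne n)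
  have h := Complex.isPrimitiveRoot_exp (4 * n) (mul_ne_zero four_ne_zero (NeZero.ne n))
  convert h using 1
  rw [omega]
  congr 1
  push_cast
  field_simp
  ring

/-- The linear character `a^r ↦ ω^{hr}` of the rotation subgroup. -/
noncomputable def rotChar (n h : ℕ) [NeZero n] : AddChar (ZMod (4 * n)) ℂ :=
  AddChar.zmodChar (4 * n) (ζ := omega n ^ h)
    (by rw [← pow_mul, mul_comm, pow_mul, (isPrimitiveRoot_omega n).pow_eq_one, one_pow])

theorem rotChar_apply (h : ℕ) (r : ZMod (4 * n)) : rotChar n h r = omega n ^ (h * r.val) := by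
  rw [rotChar, AddChar.zmodChar_apply, pow_mul]

/-- For even `h`, `2nh` is divisible by `4n`, so the second diagonal exponent `(2n-1)h` is `-h`
modulo `4n`. -/
theorem sigmaChar_a_eq_rotChar {h : ℕ} (hh : Even h) (r : ZMod (4 * n)) :
    sigmaChar n h (a r) = rotChar n h r + rotChar n h (-r) := by
  have key : omega n ^ ((2 * n - 1) * h * r.val) = omega n ^ (h * (-r).val) := by
    apply omega_pow_congr
    obtain ⟨m, rfl⟩ := hh
    simp only [Nat.cast_add, Nat.cast_mul, cast_two_mul_sub_one, ZMod.natCast_val,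
      ZMod.cast_id', id]
    linear_combination (m * r : ZMod (4 * n)) * four_mul_cast_eq_zero n
  change Matrix.trace !![omega n ^ (h * r.val), 0; 0, omega n ^ ((2 * n - 1) * h * r.val)] = _
  rw [Matrix.trace_fin_two_of, rotChar_apply, rotChar_apply, key]

theorem rotChar_one_sq_ne_one {h : ℕ} (hh : h ∈ CdagEven n) : rotChar n h 1 ^ 2 ≠ 1 := by
  obtain ⟨⟨-, hle⟩, hne⟩ := hh
  simp only [Set.mem_insert_iff, Set.mem_singleton_iff, not_or] at hne
  have h1 : rotChar n h 1 = omega n ^ h := by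
    have := NeZero.pos n
    rw [rotChar_apply, ← Nat.cast_one, ZMod.val_natCast, Nat.mod_eq_of_lt (by omega), mul_one]
  rw [h1, ← pow_mul, Ne, (isPrimitiveRoot_omega n).pow_eq_one_iff_dvd]
  intro hd
  have := Nat.le_of_dvd (by omega) hd
  omega

theorem rotChar_pow_eq_one {h : ℕ} (hh : Even h) (r : ZMod (4 * n)) :
    rotChar n h r ^ (2 * n) = 1 := by
  obtain ⟨m, rfl⟩ := hh
  rw [rotChar_apply, ← pow_mul, (isPrimitiveRoot_omega n).pow_eq_one_iff_dvd]
  exact ⟨m * r.val, by ring⟩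

/-- For odd `n` the character `ς_h` vanishes at no rotation. -/
theorem sigmaChar_a_ne_zero (hodd : Odd n) {h : ℕ} (hh : Even h) (r : ZMod (4 * n)) :
    sigmaChar n h (a r) ≠ 0 := by
  rw [sigmaChar_a_eq_rotChar hh]
  intro h0
  have hinv : rotChar n h r * rotChar n h (-r) = 1 := by
    rw [← AddChar.map_add_eq_mul, add_neg_cancel, AddChar.map_zero_eq_one]
  -- A zero means `z + z⁻¹ = 0` for `z = rotChar n h r`. Then `z^{2n} = (-1)^n = -1` for odd `n`,
  -- against `z^{2n} = 1`.
  have hsq : rotChar n h r ^ 2 = -1 := by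
    linear_combination rotChar n h r * h0 - hinv
  have hp := rotChar_pow_eq_one hh r
  rw [pow_mul, hsq, hodd.neg_one_pow] at hp
  norm_num at hp

theorem sigmaChar_a_neg {h : ℕ} (hh : Even h) (r : ZMod (4 * n)) :
    sigmaChar n h (a (-r)) = sigmaChar n h (a r) := by
  rw [sigmaChar_a_eq_rotChar hh, sigmaChar_a_eq_rotChar hh, neg_neg, add_comm]

theorem conj_sigmaChar_a {h : ℕ} (hh : Even h) (r : ZMod (4 * n)) :
    (starRingEnd ℂ) (sigmaChar n h (a r)) = sigmaChar n h (a r) := by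
  rw [sigmaChar_a_eq_rotChar hh, map_add, ← AddChar.map_neg_eq_conj, ← AddChar.map_neg_eq_conj,
    neg_neg, add_comm]

theorem sigmaChar_one {h : ℕ} (hh : Even h) : sigmaChar n h 1 = 2 := by
  rw [one_def, sigmaChar_a_eq_rotChar hh]
  norm_num

/-- With `z = rotChar n h 1`, `z²((z + z⁻¹)² - 4) = (z² - 1)²`, and `z² ≠ 1` because `0 < 2h < 4n`.
-/
theorem sigmaChar_a_one_sq_ne {h : ℕ} (hh : h ∈ CdagEven n) : sigmaChar n h (a 1) ^ 2 ≠ 4 := by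
  rw [sigmaChar_a_eq_rotChar hh.1.1]
  have hinv : rotChar n h 1 * rotChar n h (-1) = 1 := by
    rw [← AddChar.map_add_eq_mul, add_neg_cancel, AddChar.map_zero_eq_one]
  intro h4
  have : (rotChar n h 1 ^ 2 - 1) ^ 2 = 0 := by
    linear_combination rotChar n h 1 ^ 2 * h4 -
      (2 * rotChar n h 1 ^ 2 + 1 + rotChar n h 1 * rotChar n h (-1)) * hinv
  exact rotChar_one_sq_ne_one hh (sub_eq_zero.1 (pow_eq_zero_iff two_ne_zero |>.1 this))

/-- The convolution identity for `ς_h` on rotations. -/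
theorem sum_sigmaChar_mul_sigmaChar {h : ℕ} (hh : h ∈ CdagEven n) (i j : ZMod (4 * n)) :
    ∑ s, sigmaChar n h (a (s - i)) * sigmaChar n h (a (s - j)) =
      4 * n * sigmaChar n h (a (i - j)) := by
  have hz : ∑ s, rotChar n h s ^ 2 = 0 := by
    have hne : rotChar n h ^ 2 ≠ 1 := fun h1 => rotChar_one_sq_ne_one hh <| by
      simpa using congrArg (fun ψ : AddChar (ZMod (4 * n)) ℂ => ψ 1) h1
    simpa using AddChar.sum_eq_zero_of_ne_one hne
  have hz' : ∑ s, rotChar n h (-s) ^ 2 = 0 :=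
    (Equiv.sum_comp (Equiv.neg (ZMod (4 * n))) fun s => rotChar n h s ^ 2).trans hz
  -- The cross terms do not depend on `s`. The other two are multiples of the square of `rotChar n
  -- h` and of its inverse, nontrivial characters whose sums vanish.
  have hterm : ∀ s, sigmaChar n h (a (s - i)) * sigmaChar n h (a (s - j)) =
      rotChar n h (-(i + j)) * rotChar n h s ^ 2 + rotChar n h (i + j) * rotChar n h (-s) ^ 2 +
        sigmaChar n h (a (i - j)) := by
    intro s
    have hinv : rotChar n h s * rotChar n h (-s) = 1 := by
      rw [← AddChar.map_add_eq_mul, add_neg_cancel, AddChar.map_zero_eq_one]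
    simp only [sigmaChar_a_eq_rotChar hh.1.1, neg_add, neg_neg, sub_eq_add_neg,
      AddChar.map_add_eq_mul]
    linear_combination (rotChar n h i * rotChar n h (-j) + rotChar n h j * rotChar n h (-i)) * hinv
  simp only [hterm, Finset.sum_add_distrib, ← Finset.mul_sum, hz, hz', Finset.sum_const,
    Finset.card_univ, ZMod.card]
  simp

theorem sum_eq_sum_a {M : Type*} [AddCommMonoid M] (f : SemidihedralGroup n → M)
    (hf : ∀ r, f (ba r) = 0) : ∑ g, f g = ∑ r, f (a r) := by
  rw [← Equiv.sum_comp (equivSum n).symm, Fintype.sum_sum_type]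
  simp only [equivSum, Equiv.coe_fn_symm_mk, hf, Finset.sum_const_zero, add_zero]

end SemidihedralGroup

/-! ### Coordinates of symmetrized tensors and a rank bound. -/

namespace SymmetryClass

variable {ι : Type*} {V : Type*} [NormedAddCommGroup V] [InnerProductSpace ℂ V] {d : ℕ}

theorem innerTprod_basis [Fintype ι] [DecidableEq ι] (e : OrthonormalBasis (Fin d) ℂ V) (α β : ι → Fin d) :
    innerTprod (fun i => e (α i)) (PiTensorProduct.tprod ℂ fun i => e (β i)) =
      if α = β then 1 else 0 := by
  simp only [innerTprod_tprod, e.inner_eq_ite, Finset.prod_ite_zero, Finset.prod_const_one,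
    Finset.mem_univ, true_imp_iff, funext_iff]

theorem tensorInner_smul_sum [Fintype ι] {κ : Type*} (s : Finset κ) (p q : κ → ℂ) (c c' : ℂ)
    (x y : κ → ⨂[ℂ] _ : ι, V) :
    tensorInner (c • ∑ k ∈ s, p k • x k) (c' • ∑ l ∈ s, q l • y l) =
      starRingEnd ℂ c * c' *
        ∑ k ∈ s, ∑ l ∈ s, starRingEnd ℂ (p k) * q l * tensorInner (x k) (y l) := by
  simp only [tensorInner, map_smul, map_sum, LinearMap.smul_apply, LinearMap.sum_apply,
    LinearMap.map_smulₛₗ, smul_eq_mul, Finset.mul_sum]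
  refine Finset.sum_congr rfl fun k _ => Finset.sum_congr rfl fun l _ => ?_
  ring

variable {G : Type*} [Group G] [Fintype G]

theorem starTensor_eq (T : G →* Equiv.Perm ι) (χ : G → ℂ) (e : Fin d → V) (α : ι → Fin d) :
    starTensor T χ e α = (χ 1 / Fintype.card G) •
      ∑ g, χ g • PiTensorProduct.tprod ℂ fun i => e (α ((T g).symm i)) := by
  simp [starTensor, symmetrizer]

/-- The symmetrized tensor of `β` only involves basis tensors indexed by the orbit of `β`. -/
theorem innerTprod_starTensor_eq_zero [Fintype ι] (T : G →* Equiv.Perm ι)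
    (χ : G → ℂ)  (e : OrthonormalBasis (Fin d) ℂ V) {α β : ι → Fin d} (hαβ : ∀ g, α ∘ T g ≠ β) :
    innerTprod (fun i => e (α i)) (starTensor T χ e β) = 0 := by
  classical
  rw [starTensor_eq, map_smul, map_sum, Finset.sum_eq_zero, smul_zero]
  intro g _
  rw [map_smul, innerTprod_basis e α fun i => β ((T g).symm i), if_neg, smul_zero]
  rintro rfl
  exact hαβ g (funext fun i => by simp)

/-- If the image of a set `B` under a pair of functionals is supported at one point of `B`, then
the pair has rank at most one on the span of `B`. -/
theorem mul_eq_mul_of_mem_span {M : Type*} [AddCommGroup M] [Module ℂ M] {B : Set M}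
    (φ ψ : M →ₗ[ℂ] ℂ) (S : Set M) (hS : (B ∩ S).Subsingleton)
    (hφ : ∀ x ∈ B, x ∉ S → φ x = 0) (hψ : ∀ x ∈ B, x ∉ S → ψ x = 0)
    {x y : M} (hx : x ∈ Submodule.span ℂ B) (hy : y ∈ Submodule.span ℂ B) :
    φ x * ψ y = φ y * ψ x := by
  have base : ∀ x ∈ B, ∀ y ∈ B, φ x * ψ y = φ y * ψ x := by
    intro x hx y hy
    by_cases hxS : x ∈ S
    · by_cases hyS : y ∈ S
      · rw [hS ⟨hx, hxS⟩ ⟨hy, hyS⟩]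
      · rw [hφ y hy hyS, hψ y hy hyS]; ring
    · rw [hφ x hx hxS, hψ x hx hxS]; ring
  -- Both sides are bilinear in `(x, y)`, so the identity passes from `B` to its span.
  induction hx, hy using Submodule.span_induction₂ with
  | mem_mem x y hx hy => exact base x hx y hy
  | zero_left => simp
  | zero_right => simp
  | add_left x y z _ _ _ h1 h2 => rw [map_add, map_add]; linear_combination h1 + h2
  | add_right x y z _ _ _ h1 h2 => rw [map_add, map_add]; linear_combination h1 + h2
  | smul_left r x y _ _ h => simp only [map_smul, smul_eq_mul]; linear_combination r * h
  | smul_right r x y _ _ h => simp only [map_smul, smul_eq_mul]; linear_combination r * h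

end SymmetryClass

/-! ### The orbit of one-point multi-indices. -/

namespace SemidihedralGroup

open SymmetryClass

variable {n : ℕ} {d : ℕ}

/-- The multi-index with value `q` at the point `j` and `p` elsewhere. -/
def pointIndex (p q : Fin d) (j : ZMod (4 * n)) : ZMod (4 * n) → Fin d :=
  fun i => if i = j then q else p

theorem pointIndex_injective {p q : Fin d} (hpq : p ≠ q) :
    Function.Injective (pointIndex (n := n) p q) := by
  intro i j hij
  by_contra hne
  have := congrFun hij i
  simp only [pointIndex, if_true, if_neg hne] at this
  exact hpq this.symm

theorem pointIndex_comp_perm (p q : Fin d) (j : ZMod (4 * n)) (σ : Equiv.Perm (ZMod (4 * n))) :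
    pointIndex p q j ∘ σ = pointIndex p q (σ.symm j) := by
  funext i
  simp only [pointIndex, Function.comp_apply, Equiv.eq_symm_apply]

variable [NeZero n] {V : Type*} [NormedAddCommGroup V] [InnerProductSpace ℂ V]

theorem starTensor_pointIndex {h : ℕ} (hh : Even h) (e : Fin d → V) (p q : Fin d)
    (j : ZMod (4 * n)) :
    starTensor (toPerm n) (sigmaChar n h) e (pointIndex p q j) = (1 / (4 * n) : ℂ) •
      ∑ i, sigmaChar n h (a (i - j)) •
        PiTensorProduct.tprod ℂ fun t => e (pointIndex p q i t) := by
  -- The rotation taking the marked point `j` to `i` is `a^{i-j}`, and the scalar is `ς(1)/|G| =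
  -- 2/8n`.
  rw [starTensor_eq, sum_eq_sum_a _ fun r => by rw [sigmaChar_ba, zero_smul],
    ← Equiv.sum_comp (Equiv.subRight j), sigmaChar_one hh, card_eq]
  congr 1
  · have hn : (n : ℂ) ≠ 0 := Nat.cast_ne_zero.2 (NeZero.ne n)
    push_cast
    field_simp
    norm_num
  · refine Finset.sum_congr rfl fun i _ => ?_
    congr 2
    funext t
    congr 1
    have : (toPerm n (a (i - j))).symm t = t - (i - j) := sub_eq_add_neg t (i - j) ▸ rfl
    simp only [Equiv.subRight_apply, this, pointIndex]
    congr 1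
    exact propext ⟨fun h => by linear_combination h, fun h => by linear_combination h⟩

theorem innerTprod_starTensor_pointIndex {h : ℕ} (hh : Even h) (e : OrthonormalBasis (Fin d) ℂ V)
    {p q : Fin d} (hpq : p ≠ q) (i j : ZMod (4 * n)) :
    innerTprod (fun t => e (pointIndex p q i t))
      (starTensor (toPerm n) (sigmaChar n h) e (pointIndex p q j)) =
        1 / (4 * n) * sigmaChar n h (a (i - j)) := by
  rw [starTensor_pointIndex hh, map_smul, map_sum]
  simp only [map_smul, innerTprod_basis, (pointIndex_injective hpq).eq_iff, smul_eq_mul,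
    mul_ite, mul_one, mul_zero, Finset.sum_ite_eq, Finset.mem_univ, if_true]

/-- The convolution identity supplies a factor `4n` that cancels one of the two normalizing factors
`1/(4n)`. -/
theorem tensorInner_starTensor_pointIndex {h : ℕ} (hh : h ∈ CdagEven n)
    (e : OrthonormalBasis (Fin d) ℂ V) {p q : Fin d} (hpq : p ≠ q) (i j : ZMod (4 * n)) :
    tensorInner (starTensor (toPerm n) (sigmaChar n h) e (pointIndex p q i))
      (starTensor (toPerm n) (sigmaChar n h) e (pointIndex p q j)) =
        1 / (4 * n) * sigmaChar n h (a (i - j)) := by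
  have hn : (n : ℂ) ≠ 0 := Nat.cast_ne_zero.2 (NeZero.ne n)
  rw [starTensor_pointIndex hh.1.1, starTensor_pointIndex hh.1.1, tensorInner_smul_sum]
  simp only [tensorInner_tprod, ← innerTprod_tprod, innerTprod_basis,
    (pointIndex_injective hpq).eq_iff, mul_ite, mul_one, mul_zero, Finset.sum_ite_eq,
    Finset.mem_univ, if_true, conj_sigmaChar_a hh.1.1, sum_sigmaChar_mul_sigmaChar hh]
  simp only [map_div₀, map_one, map_mul, map_ofNat, map_natCast]
  field_simp

end SemidihedralGroup

/-! ### The contradiction. -/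

open SymmetryClass SemidihedralGroup in
theorem corollary3p5 {n : ℕ} [NeZero n] (hn : 2 ≤ n) (hodd : Odd n)
    {h : ℕ} (hh : h ∈ SemidihedralGroup.CdagEven n)
    {V : Type*} [NormedAddCommGroup V] [InnerProductSpace ℂ V] [FiniteDimensional ℂ V]
    (hV : 2 ≤ Module.finrank ℂ V)
    {d : ℕ} (e : OrthonormalBasis (Fin d) ℂ V) :
    ¬ SymmetryClass.HasOrthogonalStarBasis (SemidihedralGroup.toPerm n)
        (SemidihedralGroup.sigmaChar n h) e := by
  rintro ⟨B, hB, -, hspan, horth⟩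
  have hd : 2 ≤ d := by
    rwa [Module.finrank_eq_card_basis e.toBasis, Fintype.card_fin] at hV
  obtain ⟨p, q, hpq⟩ : ∃ p q : Fin d, p ≠ q :=
    ⟨⟨0, by omega⟩, ⟨1, by omega⟩, by simp⟩
  have hnC : (1 / (4 * n) : ℂ) ≠ 0 := by simp [NeZero.ne n]
  let E : ZMod (4 * n) → ⨂[ℂ] _ : ZMod (4 * n), V :=
    fun j => starTensor (toPerm n) (sigmaChar n h) e (pointIndex p q j)
  let φ : ZMod (4 * n) → (⨂[ℂ] _ : ZMod (4 * n), V) →ₗ[ℂ] ℂ :=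
    fun i => innerTprod fun t => e (pointIndex p q i t)
  have hE : ∀ j, E j ∈ Submodule.span ℂ B := fun j => hspan ▸ LinearMap.mem_range_self _ _
  -- Distinct members of `B` are orthogonal, but no two of the `E j` are.
  have hS : (B ∩ Set.range E).Subsingleton := by
    rintro _ ⟨hx, i, rfl⟩ _ ⟨hy, j, rfl⟩
    by_contra hne
    exact mul_ne_zero hnC (sigmaChar_a_ne_zero hodd hh.1.1 _)
      ((tensorInner_starTensor_pointIndex hh e hpq i j).symm.trans (horth hx hy hne))
  have hφ : ∀ i, ∀ x ∈ B, x ∉ Set.range E → φ i x = 0 := by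
    intro i x hx hxE
    obtain ⟨β, rfl⟩ := hB hx
    refine innerTprod_starTensor_eq_zero _ _ e fun g hg => hxE ?_
    rw [pointIndex_comp_perm] at hg
    exact ⟨_, congrArg (starTensor (toPerm n) (sigmaChar n h) e) hg⟩
  -- The vanishing of this 2 × 2 determinant reads `ς(1)² = ς(a)²`, that is, `ς(a)² = 4`.
  have key := mul_eq_mul_of_mem_span (φ 0) (φ 1) _ hS (hφ 0) (hφ 1) (hE 0) (hE 1)
  simp only [φ, E, innerTprod_starTensor_pointIndex hh.1.1 e hpq, sub_self, sub_zero, zero_sub,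
    ← one_def, sigmaChar_one hh.1.1, sigmaChar_a_neg hh.1.1] at key
  refine sigmaChar_a_one_sq_ne hh ?_
  exact mul_left_cancel₀ (mul_ne_zero hnC hnC)
    (show (1 / (4 * n) : ℂ) * (1 / (4 * n)) * sigmaChar n h (a 1) ^ 2 =
      1 / (4 * n) * (1 / (4 * n)) * 4 by linear_combination -key)
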